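/- For a unital $C^*$-algebra $A$ let $P_A$ be the set of continuous functions $f:[0,\infty)\to\mathbb{R}$ such that $f(x)\le f(y)$ for all self-adjoint $x,y\in A$ with spectrum in $[0,\infty)$ and $x\le y$ (where $f(x)$ is given by the continuous functional calculus). For a positive integer $n$ put $P_n=P_{M_n(\mathbb{C})}$, and let $P_\infty=\bigcap_{n\ge 1}P_n$; this is the class of operator monotone functions, that is, $P_\infty=P_{B(K)}$ for every infinite-dimensional complex Hilbert space $K$. An irreducible representation of $A$ is a unital $*$-homomorphism $\pi:A\to B(H)$, with $H\neq 0$ a complex Hilbert space, such that $0$ and $H$ are the only closed $\pi(A)$-invariant subspaces; its dimension is $\dim H$. **Lemma.** Let $A$ be a unital $C^*$-algebra. 1. If $A$ has an irreducible representation of finite dimension $n$, then $P_A\subseteq P_n$. 2. If $n$ is a positive integer and every irreducible representation of $A$ has dimension at most $n$, then $P_n\subseteq P_A$. 3. If the set of dimensions of finite-dimensional irreducible representations of $A$ is unbounded, then every $A$-monotone function is operator monotone, and in fact $P_A=P_\infty$. 4. If $A$ has an infinite-dimensional irreducible representation, then every $A$-monotone function is operator monotone, and in fact $P_A=P_\infty$.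 -/

import Mathlib

open scoped MatrixOrder

/-- The class `P_A(I)` of `A`-monotone functions on `I`: functions that are continuous on `I` and
satisfy `f(x) ≤ f(y)` for all self-adjoint `x ≤ y` in `A` with spectrum in `I`. A function on `I` is
represented by a total function `ℝ → ℝ`; membership depends only on its values on `I`. -/
def monotoneClass (I : Set ℝ) (A : Type*) [Ring A] [StarRing A] [Algebra ℝ A] [TopologicalSpace A]
    [PartialOrder A] [ContinuousFunctionalCalculus ℝ A IsSelfAdjoint] : Set (ℝ → ℝ) :=
  {f | ContinuousOn f I ∧ ∀ x y : A, IsSelfAdjoint x → IsSelfAdjoint y →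
    spectrum ℝ x ⊆ I → spectrum ℝ y ⊆ I → x ≤ y → cfc f x ≤ cfc f y}

/-- The class `P_n(I)` of matrix monotone functions of order `n` on `I`, for complex `n × n`
matrices with the Loewner order. -/
def matrixMonotoneClass (I : Set ℝ) (n : ℕ) : Set (ℝ → ℝ) :=
  monotoneClass I (Matrix (Fin n) (Fin n) ℂ)

/-- The class `P_∞(I)`, the intersection of all `P_n(I)` with `n ≥ 1`. -/
def matrixMonotoneClassInf (I : Set ℝ) : Set (ℝ → ℝ) :=
  ⋂ n : ℕ, ⋂ _ : 1 ≤ n, matrixMonotoneClass I n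

/-- A unital *-representation on a Hilbert space `H` is irreducible if `H ≠ 0` and the only closed
invariant subspaces are `0` and `H`. -/
def IsIrreducibleRep {A H : Type*} [CStarAlgebra A] [NormedAddCommGroup H] [InnerProductSpace ℂ H]
    [CompleteSpace H] (π : A →⋆ₐ[ℂ] (H →L[ℂ] H)) : Prop :=
  Nontrivial H ∧ ∀ K : Submodule ℂ H, IsClosed (K : Set H) →
    (∀ a : A, ∀ v ∈ K, π a v ∈ K) → K = ⊥ ∨ K = ⊤

/-- `A` has an irreducible representation of finite dimension `n`
(on a Hilbert space in the universe `v`). -/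
def HasIrrepOfDim.{v, u} (A : Type u) [CStarAlgebra A] (n : ℕ) : Prop :=
  ∃ (H : Type v) (_ : NormedAddCommGroup H) (_ : InnerProductSpace ℂ H) (_ : CompleteSpace H)
    (π : A →⋆ₐ[ℂ] (H →L[ℂ] H)),
    IsIrreducibleRep π ∧ FiniteDimensional ℂ H ∧ Module.finrank ℂ H = n

/-- `A` has an infinite-dimensional irreducible representation
(on a Hilbert space in the universe `v`). -/
def HasInfiniteDimIrrep.{v, u} (A : Type u) [CStarAlgebra A] : Prop :=
  ∃ (H : Type v) (_ : NormedAddCommGroup H) (_ : InnerProductSpace ℂ H) (_ : CompleteSpace H)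
    (π : A →⋆ₐ[ℂ] (H →L[ℂ] H)), IsIrreducibleRep π ∧ ¬ FiniteDimensional ℂ H

/-- Every irreducible representation of `A` has dimension at most `n`. Hilbert spaces in the
universe of `A` suffice, since an irreducible representation is cyclic and hence unitarily
equivalent to one on a completion of a quotient of `A`. -/
def IrrepDimsLE.{u} (A : Type u) [CStarAlgebra A] (n : ℕ) : Prop :=
  ∀ (H : Type u) [NormedAddCommGroup H] [InnerProductSpace ℂ H] [CompleteSpace H]
    (π : A →⋆ₐ[ℂ] (H →L[ℂ] H)), IsIrreducibleRep π →
    FiniteDimensional ℂ H ∧ Module.finrank ℂ H ≤ n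

/-- `S` is the class of operator monotone functions on `I`: it is `P_∞(I)`, and it is `P_{B(K)}(I)`
for every infinite-dimensional Hilbert space `K` (in the universe `w`). -/
def IsOperatorMonotoneClass.{w} (I : Set ℝ) (S : Set (ℝ → ℝ)) : Prop :=
  S = matrixMonotoneClassInf I ∧
    ∀ (K : Type w) [NormedAddCommGroup K] [InnerProductSpace ℂ K] [CompleteSpace K],
      ¬ FiniteDimensional ℂ K → S = monotoneClass I (K →L[ℂ] K)

universe u v w

/-!
Compression by an isometry `E → H` exhibits `M_m(ℂ)` as a corner of `B(H)` whenever `m ≤ dim H`, so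
a function monotone on `B(H)` is monotone on `M_m(ℂ)`. Conversely, operators are bounded strong
limits of their finite-dimensional compressions and the functional calculus is strongly continuous
on bounded sets, so `P_∞ ⊆ P_{B(H)}`.

For an irreducible representation `π : A → B(H)`, the image `π(A)` is strongly dense by Schur's
lemma. Strong approximation of self-adjoint operators becomes *bounded* strong approximation of
positive ones on applying `t ↦ M - M (1 + t²)⁻¹`, which is strongly continuous by the resolvent
identity. Approximating `x` and `y - x` in this way by images of positive elements of `A` transfers
`x ≤ y` to `A`, whence `P_A ⊆ P_{B(H)}`. Conversely, the pure states of `A` detect positivity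
(Hahn–Banach and Krein–Milman) and have irreducible GNS representations, so a function which is
monotone on `B(H)` for every irreducible `π` is monotone on `A`.
-/

open ContinuousLinearMap Filter Set Topology
open scoped ComplexOrder

section FunctionalCalculus

variable {A : Type*} [Ring A] [StarRing A] [Algebra ℝ A] [TopologicalSpace A] [PartialOrder A]
  [ContinuousFunctionalCalculus ℝ A IsSelfAdjoint]

lemma mem_monotoneClass_Ici_iff [StarOrderedRing A] [NonnegSpectrumClass ℝ A] {f : ℝ → ℝ} :
    f ∈ monotoneClass (Ici 0) A ↔
      ContinuousOn f (Ici 0) ∧ ∀ x y : A, 0 ≤ x → x ≤ y → cfc f x ≤ cfc f y := by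
  refine and_congr_right fun _ ↦ ⟨fun h x y hx hxy ↦ ?_, fun h x y hx _ hsx _ hxy ↦ ?_⟩
  · have hy := hx.trans hxy
    exact h x y hx.isSelfAdjoint hy.isSelfAdjoint (fun _ ht ↦ spectrum_nonneg_of_nonneg hx ht)
      (fun _ ht ↦ spectrum_nonneg_of_nonneg hy ht) hxy
  · refine h x y ?_ hxy
    rw [← cfc_id ℝ x]
    exact cfc_nonneg fun t ht ↦ hsx ht

lemma monotoneClass_subset_of_starAlgEquiv {B : Type*} [StarOrderedRing A]
    [Algebra ℂ A] [IsScalarTower ℝ ℂ A]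
    [Ring B] [StarRing B] [Algebra ℝ B] [Algebra ℂ B] [IsScalarTower ℝ ℂ B]
    [TopologicalSpace B] [PartialOrder B] [ContinuousFunctionalCalculus ℝ B IsSelfAdjoint]
    [StarOrderedRing B] [ContinuousMap.UniqueHom ℝ B]
    (I : Set ℝ) (e : A ≃⋆ₐ[ℂ] B) (he : Continuous e) :
    monotoneClass I B ⊆ monotoneClass I A := by
  rintro f ⟨hf, h⟩
  refine ⟨hf, fun x y hx hy hsx hsy hxy ↦ ?_⟩
  have hspec (z : A) : spectrum ℝ (e z) = spectrum ℝ z :=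
    AlgEquiv.spectrum_eq (e.toAlgEquiv.restrictScalars ℝ) z
  have hle := h (e x) (e y) (hx.map e) (hy.map e) (hspec x ▸ hsx) (hspec y ▸ hsy)
    (OrderHomClass.mono e hxy)
  rw [← StarAlgHomClass.map_cfc (S := ℂ) e f x (hf.mono hsx) he hx (hx.map e),
    ← StarAlgHomClass.map_cfc (S := ℂ) e f y (hf.mono hsy) he hy (hy.map e)] at hle
  simpa using OrderHomClass.mono e.symm hle

end FunctionalCalculus

lemma matrixMonotoneClass_eq (I : Set ℝ) (n : ℕ) :
    matrixMonotoneClass I n =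
      monotoneClass I (EuclideanSpace ℂ (Fin n) →L[ℂ] EuclideanSpace ℂ (Fin n)) := by
  let e := Matrix.toEuclideanCLM (𝕜 := ℂ) (n := Fin n)
  refine Subset.antisymm ?_ ?_
  · exact monotoneClass_subset_of_starAlgEquiv I e.symm
      (LinearMap.continuous_of_finiteDimensional e.symm.toAlgEquiv.toLinearMap)
  · exact monotoneClass_subset_of_starAlgEquiv I e
      (LinearMap.continuous_of_finiteDimensional e.toAlgEquiv.toLinearMap)

section PositiveElements

variable {A : Type*} [CStarAlgebra A] [PartialOrder A] [StarOrderedRing A] {f : ℝ → ℝ}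

lemma map_cfc_of_nonneg {B : Type*} [CStarAlgebra B] [PartialOrder B] [StarOrderedRing B]
    (φ : A →⋆ₐ[ℂ] B) (hf : ContinuousOn f (Ici 0)) {a : A} (ha : 0 ≤ a) :
    φ (cfc f a) = cfc f (φ a) :=
  StarAlgHomClass.map_cfc φ f a (hf.mono fun _ ht ↦ spectrum_nonneg_of_nonneg ha ht)
    (map_continuous φ) ha.isSelfAdjoint (ha.isSelfAdjoint.map φ)

lemma cfc_eq_cfcₙ_add_algebraMap (hf : ContinuousOn f (Ici 0)) {a : A} (ha : 0 ≤ a) :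
    cfc f a = cfcₙ (fun t ↦ f t - f 0) a + algebraMap ℝ A (f 0) := by
  have hq : ContinuousOn (fun t ↦ f t - f 0) (quasispectrum ℝ a) :=
    (hf.mono fun t ht ↦ quasispectrum_nonneg_of_nonneg a ha t ht).sub continuousOn_const
  rw [cfcₙ_eq_cfc hq (by simp), ← cfc_add_const (f 0) _ a
    (hq.mono (spectrum_subset_quasispectrum ℝ a)) ha.isSelfAdjoint]
  simp

lemma cfc_le_cfc_iff_cfcₙ (hf : ContinuousOn f (Ici 0)) {a b : A} (ha : 0 ≤ a) (hb : 0 ≤ b) :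
    cfc f a ≤ cfc f b ↔ cfcₙ (fun t ↦ f t - f 0) a ≤ cfcₙ (fun t ↦ f t - f 0) b := by
  rw [cfc_eq_cfcₙ_add_algebraMap hf ha, cfc_eq_cfcₙ_add_algebraMap hf hb, add_le_add_iff_right]

end PositiveElements

section Corners

variable {H K : Type*} [NormedAddCommGroup H] [InnerProductSpace ℂ H] [CompleteSpace H]
  [NormedAddCommGroup K] [InnerProductSpace ℂ K] [CompleteSpace K]

/-- The embedding `T ↦ V T V*` of `B(H)` as a corner of `B(K)` given by an isometry `V : H → K`. -/
noncomputable def cornerHom (V : H →ₗᵢ[ℂ] K) : (H →L[ℂ] H) →⋆ₙₐ[ℂ] (K →L[ℂ] K) where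
  toFun T := V.toContinuousLinearMap ∘L T ∘L adjoint V.toContinuousLinearMap
  map_smul' c T := by ext; simp
  map_zero' := by ext; simp
  map_add' S T := by ext; simp
  map_mul' S T := by
    ext x
    have h (z : H) : adjoint V.toContinuousLinearMap (V z) = z := congr($V.adjoint_comp_self z)
    simp [h]
  map_star' T := by
    simp [ContinuousLinearMap.star_eq_adjoint, ContinuousLinearMap.adjoint_comp,
      ContinuousLinearMap.comp_assoc]

/-- The compression `V* T V` to `H` of an operator `T` on `K`, for an isometry `V : H → K`. -/
noncomputable def compression (V : H →ₗᵢ[ℂ] K) (T : K →L[ℂ] K) : H →L[ℂ] H :=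
  adjoint V.toContinuousLinearMap ∘L T ∘L V.toContinuousLinearMap

lemma cornerHom_apply (V : H →ₗᵢ[ℂ] K) (T : H →L[ℂ] H) :
    cornerHom V T = V.toContinuousLinearMap ∘L T ∘L adjoint V.toContinuousLinearMap := rfl

lemma compression_cornerHom (V : H →ₗᵢ[ℂ] K) (T : H →L[ℂ] H) :
    compression V (cornerHom V T) = T := by
  ext x
  have h (z : H) : adjoint V.toContinuousLinearMap (V z) = z := congr($V.adjoint_comp_self z)
  simp [compression, cornerHom_apply, h]

lemma compression_mono (V : H →ₗᵢ[ℂ] K) : Monotone (compression V) := by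
  intro S T hST
  have h := (ContinuousLinearMap.le_def _ _).1 hST |>.adjoint_conj V.toContinuousLinearMap
  simpa [ContinuousLinearMap.le_def, compression, comp_sub, sub_comp] using h

lemma compression_nonneg (V : H →ₗᵢ[ℂ] K) {T : K →L[ℂ] K} (hT : 0 ≤ T) : 0 ≤ compression V T := by
  simpa [compression] using compression_mono V hT

lemma cornerHom_le_cornerHom_iff (V : H →ₗᵢ[ℂ] K) {S T : H →L[ℂ] H} :
    cornerHom V S ≤ cornerHom V T ↔ S ≤ T :=
  ⟨fun h ↦ by simpa only [compression_cornerHom] using compression_mono V h,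
    fun h ↦ OrderHomClass.mono (cornerHom V) h⟩

/-- `cornerHom V` is not unital, so it does not commute with `cfc f`, but it does commute with the
non-unital calculus of `f - f 0`. -/
lemma cfc_cornerHom_le_cfc_cornerHom_iff (V : H →ₗᵢ[ℂ] K) {f : ℝ → ℝ}
    (hf : ContinuousOn f (Ici 0)) {S T : H →L[ℂ] H} (hS : 0 ≤ S) (hT : 0 ≤ T) :
    cfc f (cornerHom V S) ≤ cfc f (cornerHom V T) ↔ cfc f S ≤ cfc f T := by
  have hV {R : H →L[ℂ] H} (hR : 0 ≤ R) : 0 ≤ cornerHom V R := map_nonneg (cornerHom V) hR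
  have hmap {R : H →L[ℂ] H} (hR : 0 ≤ R) :
      cornerHom V (cfcₙ (fun t ↦ f t - f 0) R) = cfcₙ (fun t ↦ f t - f 0) (cornerHom V R) :=
    NonUnitalStarAlgHom.map_cfcₙ _ _ _
      ((hf.mono fun t ht ↦ quasispectrum_nonneg_of_nonneg R hR t ht).sub continuousOn_const)
      (by simp) (map_continuous (cornerHom V)) hR.isSelfAdjoint (hV hR).isSelfAdjoint
  rw [cfc_le_cfc_iff_cfcₙ hf (hV hS) (hV hT), cfc_le_cfc_iff_cfcₙ hf hS hT, ← hmap hS, ← hmap hT,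
    cornerHom_le_cornerHom_iff]

lemma monotoneClass_subset_of_linearIsometry (V : H →ₗᵢ[ℂ] K) :
    monotoneClass (Ici 0) (K →L[ℂ] K) ⊆ monotoneClass (Ici 0) (H →L[ℂ] H) := by
  intro f hf
  rw [mem_monotoneClass_Ici_iff] at hf ⊢
  refine ⟨hf.1, fun S T hS hST ↦ ?_⟩
  rw [← cfc_cornerHom_le_cfc_cornerHom_iff V hf.1 hS (hS.trans hST)]
  exact hf.2 _ _ (map_nonneg (cornerHom V) hS) (OrderHomClass.mono (cornerHom V) hST)

end Corners

section Dimension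

lemma exists_linearIsometry_of_finrank_le_rank {𝕜 E F : Type*} [RCLike 𝕜] [NormedAddCommGroup E]
    [InnerProductSpace 𝕜 E] [FiniteDimensional 𝕜 E] [NormedAddCommGroup F] [InnerProductSpace 𝕜 F]
    (h : Module.finrank 𝕜 E ≤ Module.rank 𝕜 F) : Nonempty (E →ₗᵢ[𝕜] F) := by
  obtain ⟨v, hv⟩ := Module.le_rank_iff.1 h
  let b := stdOrthonormalBasis 𝕜 E
  let T := b.toBasis.constr 𝕜 (InnerProductSpace.gramSchmidtNormed 𝕜 v)
  have hT : T ∘ b.toBasis = InnerProductSpace.gramSchmidtNormed 𝕜 v := by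
    ext i
    simp [T]
  exact ⟨T.isometryOfOrthonormal (v := b.toBasis) (by simp)
    (hT ▸ InnerProductSpace.gramSchmidtNormed_orthonormal hv)⟩

variable {H : Type*} [NormedAddCommGroup H] [InnerProductSpace ℂ H] [CompleteSpace H] {n : ℕ}

lemma matrixMonotoneClass_subset_of_finrank_le [FiniteDimensional ℂ H]
    (h : Module.finrank ℂ H ≤ n) :
    matrixMonotoneClass (Ici 0) n ⊆ monotoneClass (Ici 0) (H →L[ℂ] H) := by
  rw [matrixMonotoneClass_eq]
  obtain ⟨V⟩ := exists_linearIsometry_of_finrank_le_rank (𝕜 := ℂ) (E := H)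
    (F := EuclideanSpace ℂ (Fin n)) (by simpa [← Module.finrank_eq_rank] using h)
  exact monotoneClass_subset_of_linearIsometry V

lemma monotoneClass_subset_matrixMonotoneClass_of_le_rank (h : n ≤ Module.rank ℂ H) :
    monotoneClass (Ici 0) (H →L[ℂ] H) ⊆ matrixMonotoneClass (Ici 0) n := by
  rw [matrixMonotoneClass_eq]
  obtain ⟨V⟩ := exists_linearIsometry_of_finrank_le_rank (𝕜 := ℂ) (E := EuclideanSpace ℂ (Fin n))
    (F := H) (by simpa using h)
  exact monotoneClass_subset_of_linearIsometry V

lemma monotoneClass_subset_matrixMonotoneClassInf (h : ¬ FiniteDimensional ℂ H) :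
    monotoneClass (Ici 0) (H →L[ℂ] H) ⊆ matrixMonotoneClassInf (Ici 0) := by
  have hrank : Cardinal.aleph0 ≤ Module.rank ℂ H := by
    rwa [← not_lt, Module.rank_lt_aleph0_iff]
  exact subset_iInter₂ fun n _ ↦ monotoneClass_subset_matrixMonotoneClass_of_le_rank
    (Cardinal.natCast_lt_aleph0.le.trans hrank)

end Dimension

section StrongLimits

variable {ι : Type*} {l : Filter ι} {M : ℝ}

lemma tendsto_apply_of_norm_le {𝕜 E F : Type*} [NontriviallyNormedField 𝕜]
    [SeminormedAddCommGroup E] [NormedSpace 𝕜 E] [SeminormedAddCommGroup F] [NormedSpace 𝕜 F]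
    {T : ι → E →L[𝕜] F} {S : E →L[𝕜] F} (hM : ∀ i, ‖T i‖ ≤ M)
    (hT : ∀ x, Tendsto (fun i ↦ T i x) l (𝓝 (S x))) {u : ι → E} {x : E}
    (hu : Tendsto u l (𝓝 x)) : Tendsto (fun i ↦ T i (u i)) l (𝓝 (S x)) := by
  have h0 : Tendsto (fun i ↦ T i (u i - x)) l (𝓝 0) := by
    refine squeeze_zero_norm (fun i ↦ (T i).le_of_opNorm_le (hM i) _) ?_
    simpa using (tendsto_sub_nhds_zero_iff.2 hu).norm.const_mul M
  simpa using h0.add (hT x)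

lemma tendsto_aeval_apply {R 𝕜 E : Type*} [CommSemiring R] [NontriviallyNormedField 𝕜]
    [SeminormedAddCommGroup E] [NormedSpace 𝕜 E] [Algebra R (E →L[𝕜] E)]
    {T : ι → E →L[𝕜] E} {S : E →L[𝕜] E} (hM : ∀ i, ‖T i‖ ≤ M)
    (hT : ∀ x, Tendsto (fun i ↦ T i x) l (𝓝 (S x))) (p : Polynomial R) (x : E) :
    Tendsto (fun i ↦ Polynomial.aeval (T i) p x) l (𝓝 (Polynomial.aeval S p x)) := by
  induction p using Polynomial.induction_on with
  | C a => simp [tendsto_const_nhds]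
  | add p q hp hq => simpa using hp.add hq
  | monomial n a ih =>
    rw [pow_succ', mul_left_comm]
    simpa only [map_mul, Polynomial.aeval_X] using! tendsto_apply_of_norm_le hM hT ih

lemma exists_polynomial_norm_aeval_sub_cfc_lt {A : Type*} [CStarAlgebra A] [PartialOrder A]
    [StarOrderedRing A] {f : ℝ → ℝ} (hf : ContinuousOn f (Ici 0)) (M : ℝ) {ε : ℝ} (hε : 0 < ε) :
    ∃ p : Polynomial ℝ, ∀ a : A, 0 ≤ a → ‖a‖ ≤ M → ‖Polynomial.aeval a p - cfc f a‖ < ε := by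
  rcases subsingleton_or_nontrivial A with _ | _
  · exact ⟨0, fun a _ _ ↦ by simpa [Subsingleton.elim (cfc f a) 0] using hε⟩
  obtain ⟨p, hp⟩ := exists_polynomial_near_of_continuousOn 0 M f
    (hf.mono Icc_subset_Ici_self) ε hε
  refine ⟨p, fun a ha haM ↦ ?_⟩
  rw [← cfc_polynomial p a ha.isSelfAdjoint,
    ← cfc_sub _ _ a (by fun_prop) (hf.mono fun t ht ↦ spectrum_nonneg_of_nonneg ha ht)]
  refine norm_cfc_lt hε fun t ht ↦ hp t ⟨spectrum_nonneg_of_nonneg ha ht, ?_⟩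
  exact (le_abs_self t).trans ((spectrum.norm_le_norm_of_mem ht).trans haM)

variable {H : Type*} [NormedAddCommGroup H] [InnerProductSpace ℂ H]

lemma le_of_tendsto_apply [l.NeBot] {T T' : ι → H →L[ℂ] H} {S S' : H →L[ℂ] H}
    (hT : ∀ ξ, Tendsto (fun i ↦ T i ξ) l (𝓝 (S ξ)))
    (hT' : ∀ ξ, Tendsto (fun i ↦ T' i ξ) l (𝓝 (S' ξ))) (hle : ∀ i, T i ≤ T' i) : S ≤ S' := by
  rw [ContinuousLinearMap.le_def, isPositive_iff_complex]
  intro ξ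
  have hlim : Tendsto (fun i ↦ inner ℂ ((T' i - T i) ξ) ξ) l (𝓝 (inner ℂ ((S' - S) ξ) ξ)) :=
    ((hT' ξ).sub (hT ξ)).inner (𝕜 := ℂ) tendsto_const_nhds
  have h0 : 0 ≤ inner ℂ ((S' - S) ξ) ξ := ge_of_tendsto' hlim fun i ↦
    ((ContinuousLinearMap.le_def _ _).1 (hle i)).inner_nonneg_left ξ
  exact ⟨Complex.ext rfl (Complex.nonneg_iff.1 h0).2, (Complex.nonneg_iff.1 h0).1⟩

variable [CompleteSpace H] {T T' : ι → H →L[ℂ] H} {S S' : H →L[ℂ] H} {f : ℝ → ℝ}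

lemma tendsto_cfc_apply (hT0 : ∀ i, 0 ≤ T i) (hM : ∀ i, ‖T i‖ ≤ M) (hS0 : 0 ≤ S)
    (hT : ∀ ξ, Tendsto (fun i ↦ T i ξ) l (𝓝 (S ξ))) (hf : ContinuousOn f (Ici 0)) (ξ : H) :
    Tendsto (fun i ↦ cfc f (T i) ξ) l (𝓝 (cfc f S ξ)) := by
  rw [Metric.tendsto_nhds]
  intro ε hε
  obtain ⟨δ, hδ, hξδ⟩ := exists_pos_mul_lt (by positivity : 0 < ε / 3) ‖ξ‖
  obtain ⟨p, hp⟩ := exists_polynomial_norm_aeval_sub_cfc_lt (A := H →L[ℂ] H) hf (max M ‖S‖) hδ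
  have happrox {R : H →L[ℂ] H} (hR0 : 0 ≤ R) (hR : ‖R‖ ≤ max M ‖S‖) :
      dist (Polynomial.aeval R p ξ) (cfc f R ξ) < ε / 3 := by
    rw [dist_eq_norm, ← sub_apply]
    refine (ContinuousLinearMap.le_of_opNorm_le _ (hp R hR0 hR).le ξ).trans_lt ?_
    rwa [mul_comm]
  filter_upwards [Metric.tendsto_nhds.1 (tendsto_aeval_apply hM hT p ξ) (ε / 3) (by positivity)]
    with i hi
  have hTi := happrox (hT0 i) ((hM i).trans (le_max_left _ _))
  have hS := happrox hS0 (le_max_right _ _)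
  calc dist (cfc f (T i) ξ) (cfc f S ξ)
      ≤ dist (cfc f (T i) ξ) (Polynomial.aeval (T i) p ξ)
        + dist (Polynomial.aeval (T i) p ξ) (Polynomial.aeval S p ξ)
        + dist (Polynomial.aeval S p ξ) (cfc f S ξ) := dist_triangle4 _ _ _ _
    _ < ε / 3 + ε / 3 + ε / 3 := by rw [dist_comm (cfc f (T i) ξ)]; gcongr
    _ = ε := add_thirds ε

lemma cfc_le_cfc_of_tendsto_apply [l.NeBot] {M' : ℝ} (hf : ContinuousOn f (Ici 0))
    (hT0 : ∀ i, 0 ≤ T i) (hM : ∀ i, ‖T i‖ ≤ M) (hT : ∀ ξ, Tendsto (fun i ↦ T i ξ) l (𝓝 (S ξ)))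
    (hT'0 : ∀ i, 0 ≤ T' i) (hM' : ∀ i, ‖T' i‖ ≤ M')
    (hT' : ∀ ξ, Tendsto (fun i ↦ T' i ξ) l (𝓝 (S' ξ))) (hle : ∀ i, cfc f (T i) ≤ cfc f (T' i)) :
    cfc f S ≤ cfc f S' := by
  have hS0 : 0 ≤ S := le_of_tendsto_apply (T := 0) (by simp) hT hT0
  have hS'0 : 0 ≤ S' := le_of_tendsto_apply (T := 0) (by simp) hT' hT'0
  exact le_of_tendsto_apply (tendsto_cfc_apply hT0 hM hS0 hT hf)
    (tendsto_cfc_apply hT'0 hM' hS'0 hT' hf) hle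

end StrongLimits

section FiniteCompressions

variable {H K : Type*} [NormedAddCommGroup H] [InnerProductSpace ℂ H] [CompleteSpace H]
  [NormedAddCommGroup K] [InnerProductSpace ℂ K] [CompleteSpace K]

lemma norm_cornerHom_compression_le (V : H →ₗᵢ[ℂ] K) (T : K →L[ℂ] K) :
    ‖cornerHom V (compression V T)‖ ≤ ‖T‖ := by
  have hV : ‖V.toContinuousLinearMap‖ ≤ 1 := V.norm_toContinuousLinearMap_le
  calc ‖cornerHom V (compression V T)‖ ≤ ‖compression V T‖ :=
        NonUnitalStarAlgHom.norm_apply_le (cornerHom V) _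
    _ ≤ ‖adjoint V.toContinuousLinearMap‖ * (‖T‖ * ‖V.toContinuousLinearMap‖) :=
        (opNorm_comp_le _ _).trans (by gcongr; exact opNorm_comp_le _ _)
    _ ≤ 1 * (‖T‖ * 1) := by rw [LinearIsometryEquiv.norm_map]; gcongr
    _ = ‖T‖ := by ring

lemma cornerHom_compression_subtypeₗᵢ (F : Submodule ℂ H) [CompleteSpace F] (T : H →L[ℂ] H) :
    cornerHom F.subtypeₗᵢ (compression F.subtypeₗᵢ T) =
      F.starProjection * T * F.starProjection := by
  have h : adjoint F.subtypeₗᵢ.toContinuousLinearMap = F.orthogonalProjectionOnto :=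
    F.adjoint_subtypeL
  rw [cornerHom_apply, compression, h]
  rfl

lemma tendsto_starProjection_span_apply {𝕜 E : Type*} [RCLike 𝕜] [NormedAddCommGroup E]
    [InnerProductSpace 𝕜 E] (x : E) :
    Tendsto (fun s : Finset E ↦ (Submodule.span 𝕜 (s : Set E)).starProjection x) atTop (𝓝 x) := by
  refine tendsto_const_nhds.congr' ?_
  filter_upwards [eventually_ge_atTop {x}] with s hs
  exact (Submodule.starProjection_eq_self_iff.2 (Submodule.subset_span (by simpa using hs))).symm

lemma tendsto_cornerHom_compression_span_apply (T : H →L[ℂ] H) (ξ : H) :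
    Tendsto (fun s : Finset H ↦ cornerHom (Submodule.span ℂ (s : Set H)).subtypeₗᵢ
      (compression (Submodule.span ℂ (s : Set H)).subtypeₗᵢ T) ξ) atTop (𝓝 (T ξ)) := by
  simp only [cornerHom_compression_subtypeₗᵢ]
  exact tendsto_apply_of_norm_le (S := 1) (fun s ↦ Submodule.starProjection_norm_le _)
    tendsto_starProjection_span_apply
    ((T.continuous.tendsto ξ).comp (tendsto_starProjection_span_apply ξ))

/-- Every operator is a bounded strong limit of its compressions to finite-dimensional
subspaces. -/
theorem matrixMonotoneClassInf_subset :
    matrixMonotoneClassInf (Ici 0) ⊆ monotoneClass (Ici 0) (H →L[ℂ] H) := by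
  intro f hf
  have hcont : ContinuousOn f (Ici 0) := (mem_iInter₂.1 hf 1 le_rfl).1
  have hfin (F : Submodule ℂ H) [FiniteDimensional ℂ F] :=
    matrixMonotoneClass_subset_of_finrank_le (H := F) (Nat.le_succ _)
      (mem_iInter₂.1 hf _ (Nat.le_add_left 1 _))
  simp only [mem_monotoneClass_Ici_iff] at hfin ⊢
  refine ⟨hcont, fun S T hS hST ↦ ?_⟩
  have hT := hS.trans hST
  refine cfc_le_cfc_of_tendsto_apply hcont
    (fun s ↦ map_nonneg _ (compression_nonneg _ hS)) (fun s ↦ norm_cornerHom_compression_le _ S)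
    (tendsto_cornerHom_compression_span_apply S)
    (fun s ↦ map_nonneg _ (compression_nonneg _ hT)) (fun s ↦ norm_cornerHom_compression_le _ T)
    (tendsto_cornerHom_compression_span_apply T) fun s ↦ ?_
  rw [cfc_cornerHom_le_cfc_cornerHom_iff _ hcont (compression_nonneg _ hS)
    (compression_nonneg _ hT)]
  exact (hfin _).2 _ _ (compression_nonneg _ hS) (compression_mono _ hST)

end FiniteCompressions

section Schur

variable {A H : Type*} [CStarAlgebra A] [NormedAddCommGroup H] [InnerProductSpace ℂ H]
  [CompleteSpace H] {π : A →⋆ₐ[ℂ] (H →L[ℂ] H)}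

namespace IsIrreducibleRep

lemma eq_zero_or_eq_zero_of_mul_eq_zero (hπ : IsIrreducibleRep π) {S R : H →L[ℂ] H}
    (hS : ∀ a, Commute S (π a)) (hSR : S * R = 0) : S = 0 ∨ R = 0 := by
  have hinv (a : A) (v : H) (hv : v ∈ S.ker) : π a v ∈ S.ker := by
    have hv' : S v = 0 := hv
    simpa [hv'] using congr($((hS a).eq) v)
  refine (hπ.2 _ S.isClosed_ker hinv).symm.imp (fun h ↦ ?_) (fun h ↦ ?_)
  · ext v
    have : v ∈ S.ker := h ▸ Submodule.mem_top
    simpa using this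
  · ext v
    have : R v ∈ S.ker := congr($hSR v)
    simpa [h] using this

/-- The positive and negative parts of `T - m` commute with the representation and have product
zero, so one of them vanishes. -/
lemma le_algebraMap_or_algebraMap_le (hπ : IsIrreducibleRep π) {T : H →L[ℂ] H}
    (hT : IsSelfAdjoint T) (hcomm : ∀ a, Commute T (π a)) (m : ℝ) :
    T ≤ algebraMap ℝ _ m ∨ algebraMap ℝ _ m ≤ T := by
  have hTm : IsSelfAdjoint (T - algebraMap ℝ _ m) := hT.sub (.algebraMap _ (.all m))
  have hcomm' (a : A) : Commute (T - algebraMap ℝ _ m) (π a) :=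
    (hcomm a).sub_left (Algebra.commute_algebraMap_left m _)
  have hpos (a : A) : Commute (T - algebraMap ℝ _ m)⁺ (π a) := by
    rw [CFC.posPart_def]
    exact (hcomm' a).cfcₙ (by rw [hTm.star_eq]; exact hcomm' a) _
  rcases hπ.eq_zero_or_eq_zero_of_mul_eq_zero hpos (CFC.posPart_mul_negPart _) with h | h
  · left
    rwa [CFC.posPart_eq_zero_iff _ hTm, sub_nonpos] at h
  · right
    rwa [CFC.negPart_eq_zero_iff _ hTm, sub_nonneg] at h

lemma exists_eq_algebraMap_of_isSelfAdjoint (hπ : IsIrreducibleRep π) {T : H →L[ℂ] H}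
    (hT : IsSelfAdjoint T) (hcomm : ∀ a, Commute T (π a)) :
    ∃ r : ℝ, T = algebraMap ℝ (H →L[ℂ] H) r := by
  have : Nontrivial H := hπ.1
  obtain ⟨s, hs⟩ := ContinuousFunctionalCalculus.spectrum_nonempty (R := ℝ) T hT
  refine ⟨s, CFC.eq_algebraMap_of_spectrum_subset_singleton T s (fun t ht ↦ ?_)⟩
  rw [mem_singleton_iff]
  have hle := hπ.le_algebraMap_or_algebraMap_le hT hcomm ((s + t) / 2)
  rw [le_algebraMap_iff_spectrum_le, algebraMap_le_iff_le_spectrum] at hle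
  rcases hle with h | h <;> linarith [h s hs, h t ht]

/-- **Schur's lemma**. -/
theorem exists_eq_algebraMap (hπ : IsIrreducibleRep π) {T : H →L[ℂ] H}
    (hcomm : ∀ a, Commute T (π a)) : ∃ c : ℂ, T = algebraMap ℂ (H →L[ℂ] H) c := by
  have hstar (a : A) : Commute (star T) (π a) := by
    simpa [map_star] using (hcomm (star a)).star_star
  have hre (a : A) : Commute (realPart T : H →L[ℂ] H) (π a) := by
    rw [realPart_apply_coe]
    exact ((hcomm a).add_left (hstar a)).smul_left _
  have him (a : A) : Commute (imaginaryPart T : H →L[ℂ] H) (π a) := by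
    rw [imaginaryPart_apply_coe]
    exact (((hcomm a).sub_left (hstar a)).smul_left _).smul_left _
  obtain ⟨r, hr⟩ := hπ.exists_eq_algebraMap_of_isSelfAdjoint (realPart T).2 hre
  obtain ⟨s, hs⟩ := hπ.exists_eq_algebraMap_of_isSelfAdjoint (imaginaryPart T).2 him
  refine ⟨r + Complex.I * s, ?_⟩
  rw [← realPart_add_I_smul_imaginaryPart T, hr, hs]
  ext v
  simp [Algebra.algebraMap_eq_smul_one, add_smul, mul_smul]

end IsIrreducibleRep

end Schur

section Commutant

variable {𝕜 A E : Type*} [RCLike 𝕜] [Semiring A] [Algebra 𝕜 A] [Star A] [NormedAddCommGroup E]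
  [InnerProductSpace 𝕜 E] [CompleteSpace E] (ρ : A →⋆ₐ[𝕜] (E →L[𝕜] E))

lemma apply_mem_orthogonal_of_invariant {K : Submodule 𝕜 E} (hK : ∀ a, ∀ x ∈ K, ρ a x ∈ K)
    (a : A) {x : E} (hx : x ∈ Kᗮ) : ρ a x ∈ Kᗮ := by
  rw [Submodule.mem_orthogonal] at hx ⊢
  intro y hy
  rw [← ContinuousLinearMap.adjoint_inner_left, ← ContinuousLinearMap.star_eq_adjoint, ← map_star]
  exact hx _ (hK _ y hy)

lemma commute_starProjection_of_invariant {K : Submodule 𝕜 E} [K.HasOrthogonalProjection]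
    (hK : ∀ a, ∀ x ∈ K, ρ a x ∈ K) (a : A) : Commute K.starProjection (ρ a) := by
  ext x
  refine Submodule.eq_starProjection_of_mem_orthogonal (hK a _ (K.starProjection_apply_mem x)) ?_
  change ρ a x - ρ a (K.starProjection x) ∈ Kᗮ
  rw [← map_sub]
  exact apply_mem_orthogonal_of_invariant ρ hK a (K.sub_starProjection_mem_orthogonal x)

/-- The cyclic subspace generated by `x` is invariant under `ρ`, so its projection lies in the
commutant. -/
lemma apply_mem_closure_range_of_commute_commutant {S : E →L[𝕜] E}
    (hS : ∀ R : E →L[𝕜] E, (∀ a, Commute R (ρ a)) → Commute R S) (x : E) :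
    S x ∈ closure (range fun a ↦ ρ a x) := by
  let L : A →ₗ[𝕜] E := (ContinuousLinearMap.apply 𝕜 E x).toLinearMap ∘ₗ (ρ : A →ₗ[𝕜] E →L[𝕜] E)
  let K : Submodule 𝕜 E := (LinearMap.range L).topologicalClosure
  have hLK (a : A) : ρ a x ∈ K := Submodule.le_topologicalClosure _ ⟨a, rfl⟩
  have hK (a : A) (y : E) (hy : y ∈ K) : ρ a y ∈ K := by
    refine closure_minimal (t := ρ a ⁻¹' K) ?_
      ((Submodule.isClosed_topologicalClosure _).preimage (ρ a).continuous) hy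
    rintro _ ⟨b, rfl⟩
    simpa [L] using hLK (a * b)
  have hcomm := hS K.starProjection (commute_starProjection_of_invariant ρ hK)
  have hxK : K.starProjection x = x :=
    Submodule.starProjection_eq_self_iff.2 (by simpa using hLK 1)
  have hSx : S x ∈ K := by
    rw [← Submodule.starProjection_eq_self_iff]
    simpa [hxK] using congr($hcomm.eq x)
  exact hSx

end Commutant

section RealSpan

lemma mem_closure_of_forall_re_inner_eq_zero {E : Type*} [NormedAddCommGroup E]
    [InnerProductSpace ℂ E] [CompleteSpace E] (K : Submodule ℝ E) {x : E}
    (h : ∀ y, (∀ z ∈ K, (inner ℂ y z).re = 0) → (inner ℂ y x).re = 0) :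
    x ∈ closure (K : Set E) := by
  let _ : InnerProductSpace ℝ E := .complexToReal
  have hx : x ∈ Kᗮᗮ := (Submodule.mem_orthogonal _ _).2 fun y hy ↦
    h y fun z hz ↦ (Submodule.mem_orthogonal' _ _).1 hy z hz
  rw [Submodule.orthogonal_orthogonal_eq_closure] at hx
  exact hx

variable {A E : Type*} [Ring A] [StarRing A] [Algebra ℂ A] [StarModule ℂ A]
  [NormedAddCommGroup E] [InnerProductSpace ℂ E] [CompleteSpace E]

lemma re_inner_apply_swap {S : E →L[ℂ] E} (x y : E) :
    (inner ℂ x (S y)).re = (inner ℂ y (star S x)).re := by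
  rw [ContinuousLinearMap.star_eq_adjoint, ContinuousLinearMap.adjoint_inner_right]
  exact inner_re_symm (𝕜 := ℂ) _ _

/-- If `y` is real-orthogonal to `ρ c x` for all self-adjoint `c`, then
`re ⟪y, ρ a x⟫ + re ⟪x, ρ a y⟫ = re ⟪y, ρ (a + a*) x⟫` vanishes for all `a`, hence so does its
limit `2 re ⟪y, S x⟫`. -/
lemma apply_mem_closure_range_selfAdjoint (ρ : A →⋆ₐ[ℂ] (E →L[ℂ] E)) {l : Filter A} [l.NeBot]
    {S : E →L[ℂ] E} (hS : IsSelfAdjoint S) (hl : ∀ x, Tendsto (fun a ↦ ρ a x) l (𝓝 (S x)))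
    (x : E) : S x ∈ closure (range fun c : selfAdjoint A ↦ ρ c x) := by
  let L : selfAdjoint A →ₗ[ℝ] E :=
    { toFun c := ρ c x
      map_add' c d := by simp
      map_smul' r c := by
        rw [selfAdjoint.val_smul, ← Complex.coe_smul, map_smul]
        simp }
  refine mem_closure_of_forall_re_inner_eq_zero (LinearMap.range L) fun y hy ↦ ?_
  have hA (a : A) : (inner ℂ y (ρ a x)).re + (inner ℂ x (ρ a y)).re = 0 := by
    rw [re_inner_apply_swap x y, ← map_star, ← Complex.add_re, ← inner_add_right, ← add_apply,
      ← map_add]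
    exact hy _ ⟨⟨a + star a, .add_star_self a⟩, rfl⟩
  have hlim : Tendsto (fun a ↦ (inner ℂ y (ρ a x)).re + (inner ℂ x (ρ a y)).re) l
      (𝓝 ((inner ℂ y (S x)).re + (inner ℂ x (S y)).re)) :=
    (Complex.continuous_re.tendsto _ |>.comp (tendsto_const_nhds.inner (hl x))).add
      (Complex.continuous_re.tendsto _ |>.comp (tendsto_const_nhds.inner (hl y)))
  simp only [hA] at hlim
  rw [re_inner_apply_swap x y, hS.star_eq] at hlim
  linarith [tendsto_nhds_unique hlim tendsto_const_nhds]

end RealSpan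

section Ampliation

variable {H : Type*} [NormedAddCommGroup H] [InnerProductSpace ℂ H] [CompleteSpace H]

/-- The ampliation `T ↦ T ⊗ 1` of operators on `H` to the Hilbert sum of copies of `H` indexed by
`ι`. -/
noncomputable def ampliation (H : Type*) [NormedAddCommGroup H] [InnerProductSpace ℂ H]
    [CompleteSpace H] (ι : Type*) [Fintype ι] :
    (H →L[ℂ] H) →⋆ₐ[ℂ] (PiLp 2 (fun _ : ι ↦ H) →L[ℂ] PiLp 2 (fun _ : ι ↦ H)) where
  toFun T := (PiLp.continuousLinearEquiv 2 ℂ (fun _ : ι ↦ H)).symm.toContinuousLinearMap ∘L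
    ContinuousLinearMap.pi fun i ↦ T ∘L PiLp.proj 2 (fun _ : ι ↦ H) i
  map_one' := rfl
  map_mul' _ _ := rfl
  map_zero' := rfl
  map_add' _ _ := rfl
  commutes' _ := rfl
  map_star' T := by
    rw [ContinuousLinearMap.star_eq_adjoint, ContinuousLinearMap.star_eq_adjoint,
      ContinuousLinearMap.eq_adjoint_iff]
    intro v w
    simp [PiLp.inner_apply, ContinuousLinearMap.adjoint_inner_left]

variable {ι : Type*} [Fintype ι]

@[simp]
lemma ampliation_apply (T : H →L[ℂ] H) (v : PiLp 2 (fun _ : ι ↦ H)) (i : ι) :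
    ampliation H ι T v i = T (v i) := rfl

lemma tendsto_ampliation_apply {X : Type*} {l : Filter X} {Φ : X → H →L[ℂ] H} {T : H →L[ℂ] H}
    (h : ∀ ξ, Tendsto (fun x ↦ Φ x ξ) l (𝓝 (T ξ))) (v : PiLp 2 (fun _ : ι ↦ H)) :
    Tendsto (fun x ↦ ampliation H ι (Φ x) v) l (𝓝 (ampliation H ι T v)) :=
  ((PiLp.continuous_toLp 2 _).tendsto _).comp (tendsto_pi_nhds.2 fun i ↦ h (v i))

/-- Pointwise approximation is detected on finite sets of vectors, each of which is a single vector
for an ampliation. -/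
lemma exists_filter_tendsto_apply_of_mem_closure {X : Type*} {Φ : X → H →L[ℂ] H} {T : H →L[ℂ] H}
    (h : ∀ (s : Finset H) (v : PiLp 2 (fun _ : s ↦ H)),
      ampliation H s T v ∈ closure (range fun x ↦ ampliation H s (Φ x) v)) :
    ∃ l : Filter X, l.NeBot ∧ ∀ ξ, Tendsto (fun x ↦ Φ x ξ) l (𝓝 (T ξ)) := by
  refine ⟨comap (fun x ↦ ⇑(Φ x)) (𝓝 T), comap_neBot_iff.2 fun U hU ↦ ?_, fun ξ ↦
    ((continuous_apply ξ).tendsto _).comp tendsto_comap⟩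
  rw [nhds_pi, Filter.mem_pi'] at hU
  obtain ⟨s, t, ht, hsU⟩ := hU
  have hnhds : {w : PiLp 2 (fun _ : s ↦ H) | ∀ ξ : s, w ξ ∈ t ξ} ∈
      𝓝 (ampliation H s T (WithLp.toLp 2 fun ξ ↦ ξ)) := by
    simp only [ofPred_forall, iInter_mem]
    exact fun ξ ↦ (PiLp.continuous_apply 2 (fun _ : s ↦ H) ξ).tendsto _ (ht ξ)
  obtain ⟨_, hw, x, rfl⟩ := mem_closure_iff_nhds.1 (h s _) _ hnhds
  exact ⟨x, hsU fun ξ hξ ↦ hw ⟨ξ, hξ⟩⟩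

variable {A : Type*} [CStarAlgebra A] {π : A →⋆ₐ[ℂ] (H →L[ℂ] H)}

namespace IsIrreducibleRep

/-- By Schur's lemma, the matrix entries of an operator in the commutant of the ampliated
representation are scalars. -/
lemma commute_ampliation (hπ : IsIrreducibleRep π)
    {P : PiLp 2 (fun _ : ι ↦ H) →L[ℂ] PiLp 2 (fun _ : ι ↦ H)}
    (hP : ∀ a, Commute P (ampliation H ι (π a))) (T : H →L[ℂ] H) :
    Commute P (ampliation H ι T) := by
  classical
  let single (j : ι) : H →L[ℂ] PiLp 2 (fun _ : ι ↦ H) :=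
    (PiLp.continuousLinearEquiv 2 ℂ (fun _ : ι ↦ H)).symm.toContinuousLinearMap ∘L
      ContinuousLinearMap.single ℂ (fun _ : ι ↦ H) j
  have hsingle (S : H →L[ℂ] H) (j : ι) (x : H) :
      single j (S x) = ampliation H ι S (single j x) := by
    ext i
    by_cases h : i = j
    · subst h; simp [single]
    · simp [single, h]
  have hsum (v : PiLp 2 (fun _ : ι ↦ H)) : v = ∑ j, single j (v j) := by
    ext i
    simp [single, Pi.single_apply, WithLp.ofLp_sum]
  let Q (i j : ι) : H →L[ℂ] H := PiLp.proj 2 (fun _ : ι ↦ H) i ∘L P ∘L single j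
  have hQπ (i j : ι) (a : A) : Commute (Q i j) (π a) := by
    ext x
    simpa [Q, hsingle] using congr($(hP a) (single j x) i)
  have hQT (i j : ι) : Commute (Q i j) T := by
    obtain ⟨c, hc⟩ := hπ.exists_eq_algebraMap (hQπ i j)
    exact hc ▸ Algebra.commute_algebraMap_left c T
  ext v i
  calc P (ampliation H ι T v) i = ∑ j, Q i j (T (v j)) := by
        conv_lhs => rw [hsum (ampliation H ι T v)]
        simp [Q, WithLp.ofLp_sum, Finset.sum_apply]
    _ = ∑ j, T (Q i j (v j)) := Finset.sum_congr rfl fun j _ ↦ congr($(hQT i j) (v j))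
    _ = T (P v i) := by
        conv_rhs => rw [hsum v]
        simp [Q, WithLp.ofLp_sum, Finset.sum_apply]

/-- A topological form of the **Jacobson density theorem**. -/
theorem exists_filter_tendsto (hπ : IsIrreducibleRep π) (T : H →L[ℂ] H) :
    ∃ l : Filter A, l.NeBot ∧ ∀ ξ, Tendsto (fun a ↦ π a ξ) l (𝓝 (T ξ)) :=
  exists_filter_tendsto_apply_of_mem_closure fun s v ↦
    apply_mem_closure_range_of_commute_commutant ((ampliation H s).comp π)
      (fun _ hR ↦ hπ.commute_ampliation hR T) v

theorem exists_filter_selfAdjoint_tendsto (hπ : IsIrreducibleRep π) {T : H →L[ℂ] H}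
    (hT : IsSelfAdjoint T) :
    ∃ l : Filter (selfAdjoint A), l.NeBot ∧
      ∀ ξ, Tendsto (fun c : selfAdjoint A ↦ π c ξ) l (𝓝 (T ξ)) := by
  obtain ⟨l, hl, hlim⟩ := hπ.exists_filter_tendsto T
  exact exists_filter_tendsto_apply_of_mem_closure fun s v ↦
    apply_mem_closure_range_selfAdjoint ((ampliation H s).comp π) (hT.map _)
      (tendsto_ampliation_apply hlim) v

end IsIrreducibleRep

end Ampliation

section Kaplansky

/-- The element `(1 + a²)⁻¹`, for `a` self-adjoint. -/
noncomputable def invOneAddSq {A : Type*} [CStarAlgebra A] (a : A) : A :=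
  cfc (fun t : ℝ ↦ (1 + t ^ 2)⁻¹) a

lemma continuous_inv_one_add_sq : Continuous fun t : ℝ ↦ (1 + t ^ 2)⁻¹ :=
  (by fun_prop : Continuous fun t : ℝ ↦ 1 + t ^ 2).inv₀ fun t ↦ by positivity

lemma continuous_const_sub_mul_inv_one_add_sq (M : ℝ) :
    Continuous fun t : ℝ ↦ M - M * (1 + t ^ 2)⁻¹ :=
  continuous_const.sub (continuous_const.mul continuous_inv_one_add_sq)

lemma inv_one_add_sq_mem_Icc (t : ℝ) : (1 + t ^ 2)⁻¹ ∈ Icc (0 : ℝ) 1 :=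
  ⟨by positivity, inv_le_one_of_one_le₀ (by nlinarith [sq_nonneg t])⟩

section CStarAlgebra

variable {A : Type*} [CStarAlgebra A] {a b : A}

lemma invOneAddSq_mul_one_add_sq (ha : IsSelfAdjoint a) : invOneAddSq a * (1 + a ^ 2) = 1 := by
  have h : 1 + a ^ 2 = cfc (fun t : ℝ ↦ 1 + t ^ 2) a := by
    rw [cfc_add .., cfc_const_one .., cfc_pow_id ..]
  rw [invOneAddSq, h, ← cfc_mul _ _ a continuous_inv_one_add_sq.continuousOn (by fun_prop)]
  conv_rhs => rw [← cfc_const_one ℝ a]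
  exact cfc_congr fun t _ ↦ inv_mul_cancel₀ (by positivity)

lemma one_add_sq_mul_invOneAddSq (ha : IsSelfAdjoint a) : (1 + a ^ 2) * invOneAddSq a = 1 := by
  have h : Commute a (1 + a ^ 2) :=
    (Commute.one_right a).add_right ((Commute.refl a).pow_right 2)
  have hcomm : Commute (invOneAddSq a) (1 + a ^ 2) := h.cfc (ha.star_eq.symm ▸ h) _
  rw [← hcomm.eq, invOneAddSq_mul_one_add_sq ha]

lemma norm_invOneAddSq_le (a : A) : ‖invOneAddSq a‖ ≤ 1 :=
  norm_cfc_le zero_le_one fun t _ ↦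
    (Real.norm_of_nonneg (inv_one_add_sq_mem_Icc t).1).trans_le (inv_one_add_sq_mem_Icc t).2

lemma norm_invOneAddSq_mul_self_le (ha : IsSelfAdjoint a) : ‖invOneAddSq a * a‖ ≤ 1 := by
  have h : invOneAddSq a * a = cfc (fun t : ℝ ↦ (1 + t ^ 2)⁻¹ * t) a := by
    rw [cfc_mul _ _ a continuous_inv_one_add_sq.continuousOn (by fun_prop), cfc_id' ℝ a,
      invOneAddSq]
  rw [h]
  refine norm_cfc_le zero_le_one fun t _ ↦ ?_
  rw [norm_mul, norm_inv, Real.norm_of_nonneg (by positivity : 0 ≤ 1 + t ^ 2),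
    inv_mul_le_iff₀ (by positivity), Real.norm_eq_abs]
  nlinarith [sq_nonneg (|t| - 1), sq_abs t]

lemma invOneAddSq_sub_invOneAddSq (ha : IsSelfAdjoint a) (hb : IsSelfAdjoint b) :
    invOneAddSq a - invOneAddSq b =
      invOneAddSq a * ((b - a) * (b * invOneAddSq b)) +
        invOneAddSq a * a * ((b - a) * invOneAddSq b) := by
  calc invOneAddSq a - invOneAddSq b
      = invOneAddSq a * ((1 + b ^ 2) * invOneAddSq b)
        - (invOneAddSq a * (1 + a ^ 2)) * invOneAddSq b := by
        rw [one_add_sq_mul_invOneAddSq hb, invOneAddSq_mul_one_add_sq ha, mul_one, one_mul]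
    _ = _ := by noncomm_ring

lemma cfc_const_sub_mul_inv_one_add_sq (ha : IsSelfAdjoint a) (M : ℝ) :
    cfc (fun t : ℝ ↦ M - M * (1 + t ^ 2)⁻¹) a = algebraMap ℝ A M - M • invOneAddSq a := by
  have hc := continuous_inv_one_add_sq.continuousOn (s := spectrum ℝ a)
  rw [cfc_sub (fun _ ↦ M) (fun t ↦ M * (1 + t ^ 2)⁻¹) a continuousOn_const
    (continuousOn_const.mul hc), cfc_const M a, cfc_const_mul M _ a hc, invOneAddSq]

lemma sub_smul_invOneAddSq_nonneg [PartialOrder A] [StarOrderedRing A] (ha : IsSelfAdjoint a)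
    {M : ℝ} (hM : 0 ≤ M) : 0 ≤ algebraMap ℝ A M - M • invOneAddSq a := by
  rw [← cfc_const_sub_mul_inv_one_add_sq ha]
  exact cfc_nonneg fun t _ ↦ sub_nonneg.2 (mul_le_of_le_one_right hM (inv_one_add_sq_mem_Icc t).2)

lemma norm_sub_smul_invOneAddSq_le (ha : IsSelfAdjoint a) {M : ℝ} (hM : 0 ≤ M) :
    ‖algebraMap ℝ A M - M • invOneAddSq a‖ ≤ M := by
  rw [← cfc_const_sub_mul_inv_one_add_sq ha]
  refine norm_cfc_le hM fun t _ ↦ ?_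
  obtain ⟨h0, h1⟩ := inv_one_add_sq_mem_Icc t
  rw [Real.norm_of_nonneg (sub_nonneg.2 (mul_le_of_le_one_right hM h1))]
  exact sub_le_self _ (mul_nonneg hM h0)

/-- The function `√(t / (M - t))` inverts `t ↦ M - M (1 + t²)⁻¹`. -/
lemma exists_isSelfAdjoint_sub_smul_invOneAddSq_eq [PartialOrder A] [StarOrderedRing A]
    (ha : 0 ≤ a) {M : ℝ} (hM : ∀ t ∈ spectrum ℝ a, t < M) :
    ∃ b : A, IsSelfAdjoint b ∧ algebraMap ℝ A M - M • invOneAddSq b = a := by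
  let g : ℝ → ℝ := fun t ↦ √(t / (M - t))
  have hg : ContinuousOn g (spectrum ℝ a) :=
    (continuousOn_id.div (by fun_prop) fun t ht ↦ (sub_pos.2 (hM t ht)).ne').sqrt
  refine ⟨cfc g a, cfc_predicate g a, ?_⟩
  rw [← cfc_const_sub_mul_inv_one_add_sq (cfc_predicate g a),
    ← cfc_comp' _ g a (continuous_const_sub_mul_inv_one_add_sq M).continuousOn hg]
  conv_rhs => rw [← cfc_id' ℝ a]
  refine cfc_congr fun t ht ↦ ?_
  have ht0 : 0 ≤ t := spectrum_nonneg_of_nonneg ha ht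
  have htM : 0 < M - t := sub_pos.2 (hM t ht)
  have hM0 : M ≠ 0 := by linarith
  have hgt : 1 + g t ^ 2 = M / (M - t) := by
    rw [Real.sq_sqrt (div_nonneg ht0 htM.le)]
    field_simp
    ring
  simp only [hgt]
  field_simp
  ring

open scoped CStarAlgebra in
lemma map_sub_smul_invOneAddSq {B : Type*} [CStarAlgebra B] (φ : A →⋆ₐ[ℂ] B)
    (ha : IsSelfAdjoint a) (M : ℝ) :
    φ (algebraMap ℝ A M - M • invOneAddSq a) = algebraMap ℝ B M - M • invOneAddSq (φ a) := by
  rw [← cfc_const_sub_mul_inv_one_add_sq ha, ← cfc_const_sub_mul_inv_one_add_sq (ha.map φ)]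
  exact StarAlgHomClass.map_cfc φ _ a (continuous_const_sub_mul_inv_one_add_sq M).continuousOn
    (map_continuous φ) ha (ha.map φ)

end CStarAlgebra

variable {A H : Type*} [CStarAlgebra A] [NormedAddCommGroup H] [InnerProductSpace ℂ H]
  [CompleteSpace H] {π : A →⋆ₐ[ℂ] (H →L[ℂ] H)}

/-- By the resolvent identity, the difference is `(S - s i)` applied to fixed vectors, multiplied by
uniformly bounded operators. -/
lemma tendsto_invOneAddSq_apply {ι : Type*} {l : Filter ι} {s : ι → H →L[ℂ] H} {S : H →L[ℂ] H}
    (hs : ∀ i, IsSelfAdjoint (s i)) (hS : IsSelfAdjoint S)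
    (h : ∀ ξ, Tendsto (fun i ↦ s i ξ) l (𝓝 (S ξ))) (ξ : H) :
    Tendsto (fun i ↦ invOneAddSq (s i) ξ) l (𝓝 (invOneAddSq S ξ)) := by
  rw [tendsto_iff_norm_sub_tendsto_zero]
  have hlim (v : H) : Tendsto (fun i ↦ ‖(S - s i) v‖) l (𝓝 0) := by
    simpa using ((tendsto_const_nhds (x := S v)).sub (h v)).norm
  refine squeeze_zero (fun _ ↦ norm_nonneg _) (fun i ↦ ?_)
    (by simpa using (hlim (S (invOneAddSq S ξ))).add (hlim (invOneAddSq S ξ)))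
  rw [← sub_apply, invOneAddSq_sub_invOneAddSq (hs i) hS]
  refine (norm_add_le _ _).trans (add_le_add ?_ ?_)
  · simpa using (invOneAddSq (s i)).le_of_opNorm_le (norm_invOneAddSq_le _)
      ((S - s i) (S (invOneAddSq S ξ)))
  · simpa using (invOneAddSq (s i) * s i).le_of_opNorm_le (norm_invOneAddSq_mul_self_le (hs i))
      ((S - s i) (invOneAddSq S ξ))

variable [PartialOrder A] [StarOrderedRing A]

namespace IsIrreducibleRep

/-- A form of the **Kaplansky density theorem**. -/
theorem exists_filter_nonneg_tendsto (hπ : IsIrreducibleRep π) {T : H →L[ℂ] H} (hT : 0 ≤ T) :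
    ∃ (M : ℝ) (l : Filter (selfAdjoint A)) (a : selfAdjoint A → A), l.NeBot ∧ (∀ i, 0 ≤ a i) ∧
      (∀ i, ‖a i‖ ≤ M) ∧ ∀ ξ, Tendsto (fun i ↦ π (a i) ξ) l (𝓝 (T ξ)) := by
  have : Nontrivial H := hπ.1
  let M : ℝ := ‖T‖ + 1
  have hM0 : 0 ≤ M := by positivity
  have hM (t : ℝ) (ht : t ∈ spectrum ℝ T) : t < M :=
    ((le_abs_self t).trans (spectrum.norm_le_norm_of_mem ht)).trans_lt (lt_add_one _)
  obtain ⟨S, hS, hST⟩ := exists_isSelfAdjoint_sub_smul_invOneAddSq_eq hT hM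
  obtain ⟨l, hl, hlim⟩ := hπ.exists_filter_selfAdjoint_tendsto hS
  refine ⟨M, l, fun s ↦ algebraMap ℝ A M - M • invOneAddSq (s : A), hl,
    fun s ↦ sub_smul_invOneAddSq_nonneg s.2 hM0, fun s ↦ norm_sub_smul_invOneAddSq_le s.2 hM0,
    fun ξ ↦ ?_⟩
  simp only [fun s : selfAdjoint A ↦ map_sub_smul_invOneAddSq π s.2 M]
  rw [← hST]
  exact tendsto_const_nhds.sub
    ((tendsto_invOneAddSq_apply (fun s ↦ s.2.map π) hS hlim ξ).const_smul M)

theorem monotoneClass_subset (hπ : IsIrreducibleRep π) :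
    monotoneClass (Ici 0) A ⊆ monotoneClass (Ici 0) (H →L[ℂ] H) := by
  intro f hf
  rw [mem_monotoneClass_Ici_iff] at hf ⊢
  refine ⟨hf.1, fun x y hx hxy ↦ ?_⟩
  obtain ⟨M, l, a, hl, ha0, haM, ha⟩ := hπ.exists_filter_nonneg_tendsto hx
  obtain ⟨N, l', d, hl', hd0, hdN, hd⟩ := hπ.exists_filter_nonneg_tendsto (sub_nonneg.2 hxy)
  have hnorm (c : A) : ‖π c‖ ≤ ‖c‖ := NonUnitalStarAlgHom.norm_apply_le π c
  have hb0 (i : selfAdjoint A × selfAdjoint A) : 0 ≤ a i.1 + d i.2 := add_nonneg (ha0 _) (hd0 _)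
  have ha' (ξ : H) : Tendsto (fun i : selfAdjoint A × selfAdjoint A ↦ π (a i.1) ξ) (l ×ˢ l')
      (𝓝 (x ξ)) := (ha ξ).comp tendsto_fst
  refine cfc_le_cfc_of_tendsto_apply (l := l ×ˢ l') (T := fun i ↦ π (a i.1))
    (T' := fun i ↦ π (a i.1 + d i.2)) (M := M) (M' := M + N) hf.1 (fun i ↦ map_nonneg π (ha0 _))
    (fun i ↦ (hnorm _).trans (haM _)) ha' (fun i ↦ map_nonneg π (hb0 i))
    (fun i ↦ (hnorm _).trans ((norm_add_le _ _).trans (add_le_add (haM _) (hdN _))))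
    (fun ξ ↦ by simpa using (ha' ξ).add ((hd ξ).comp tendsto_snd)) fun i ↦ ?_
  rw [← map_cfc_of_nonneg π hf.1 (ha0 _), ← map_cfc_of_nonneg π hf.1 (hb0 i)]
  exact OrderHomClass.mono π (hf.2 _ _ (ha0 _) (le_add_of_nonneg_right (hd0 _)))

end IsIrreducibleRep

end Kaplansky

section States

variable (A : Type*) [CStarAlgebra A] [PartialOrder A]

/-- The state space of `A`, in the weak-* topology. -/
def stateSpace : Set (WeakDual ℂ A) :=
  {φ | (∀ a, 0 ≤ a → 0 ≤ φ a) ∧ φ 1 = 1}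

lemma convex_stateSpace : Convex ℝ (stateSpace A) := by
  rintro φ ⟨hφ, hφ1⟩ ψ ⟨hψ, hψ1⟩ s t hs ht hst
  refine ⟨fun a ha ↦ add_nonneg (smul_nonneg hs (hφ a ha)) (smul_nonneg ht (hψ a ha)), ?_⟩
  change s • φ 1 + t • ψ 1 = 1
  rw [hφ1, hψ1, ← add_smul, hst, one_smul]

lemma isClosed_stateSpace : IsClosed (stateSpace A) := by
  simp only [stateSpace, ofPred_and, ofPred_forall]
  exact (isClosed_iInter fun a ↦ isClosed_iInter fun _ ↦
    isClosed_le continuous_const (WeakDual.eval_continuous a)).inter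
    (isClosed_eq (WeakDual.eval_continuous 1) continuous_const)

variable {A} [StarOrderedRing A]

lemma norm_apply_le_four_mul_of_nonneg {φ : A →ₗ[ℂ] ℂ} (hφ : ∀ a, 0 ≤ a → 0 ≤ φ a) (a : A) :
    ‖φ a‖ ≤ 4 * (‖φ 1‖ * ‖a‖) := by
  obtain ⟨y, hy0, hyn, hy⟩ := CStarAlgebra.exists_sum_four_nonneg a
  have hbound (i : Fin 4) : ‖φ (y i)‖ ≤ ‖φ 1‖ * ‖a‖ :=
    ((PositiveLinearMap.mk₀ φ hφ).norm_apply_le_of_nonneg _ (hy0 i)).trans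
      (mul_le_mul_of_nonneg_left (hyn i) (norm_nonneg _))
  calc ‖φ a‖ = ‖∑ i : Fin 4, φ (Complex.I ^ (i : ℕ) • y i)‖ := by rw [← map_sum, ← hy]
    _ ≤ ∑ i : Fin 4, ‖φ (Complex.I ^ (i : ℕ) • y i)‖ := norm_sum_le _ _
    _ ≤ ∑ _ : Fin 4, ‖φ 1‖ * ‖a‖ :=
        Finset.sum_le_sum fun i _ ↦ by simpa [norm_smul] using hbound i
    _ = 4 * (‖φ 1‖ * ‖a‖) := by simp

variable (A) in
lemma isCompact_stateSpace : IsCompact (stateSpace A) := by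
  refine WeakDual.isCompact_of_bounded_of_closed ?_ (isClosed_stateSpace A)
  refine (Metric.isBounded_closedBall (x := (0 : StrongDual ℂ A)) (r := 4)).subset
    fun φ ⟨hφ, hφ1⟩ ↦ ?_
  rw [mem_closedBall_zero_iff]
  refine φ.opNorm_le_bound zero_le_four fun a ↦ ?_
  simpa [show φ 1 = 1 from hφ1] using norm_apply_le_four_mul_of_nonneg (φ := φ.toLinearMap) hφ a

/-- The separating real functional `f` becomes positive on complexifying `b ↦ f (b + b*)`. -/
lemma exists_nonneg_apply_neg {a : A} (ha : IsSelfAdjoint a) (hneg : ¬ 0 ≤ a) :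
    ∃ φ : StrongDual ℂ A, (∀ b, 0 ≤ b → 0 ≤ φ b) ∧ φ a < 0 := by
  obtain ⟨f, hf, hfa⟩ := (ProperCone.positive ℝ A).hyperplane_separation_point (x₀ := a) hneg
  let φ : StrongDual ℂ A :=
    StrongDual.extendRCLike (f ∘L (.id ℝ A + (starL' ℝ : A ≃L[ℝ] A).toContinuousLinearMap))
  have hφ {b : A} (hb : IsSelfAdjoint b) : φ b = (2 * f b : ℝ) := by
    simp [φ, hb.star_eq, two_mul, StrongDual.extendRCLike_apply]
  refine ⟨φ, fun b hb ↦ ?_, ?_⟩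
  · rw [hφ hb.isSelfAdjoint]
    exact_mod_cast mul_nonneg zero_le_two (hf b hb)
  · rw [hφ ha]
    exact_mod_cast mul_neg_of_pos_of_neg two_pos hfa

lemma nonneg_of_forall_stateSpace {a : A} (ha : IsSelfAdjoint a)
    (h : ∀ φ ∈ stateSpace A, 0 ≤ φ a) : 0 ≤ a := by
  by_contra hneg
  obtain ⟨φ, hφ, hφa⟩ := exists_nonneg_apply_neg ha hneg
  have hφ1 : 0 < φ 1 := by
    refine (hφ 1 zero_le_one).lt_of_ne' fun h1 ↦ hφa.ne ?_
    simpa [h1] using norm_apply_le_four_mul_of_nonneg (φ := φ.toLinearMap) hφ a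
  have hinv : 0 < (φ 1)⁻¹ := inv_pos.2 hφ1
  have hψ : 0 ≤ (φ 1)⁻¹ * φ a := h (StrongDual.toWeakDual ((φ 1)⁻¹ • φ))
    ⟨fun b hb ↦ mul_nonneg hinv.le (hφ b hb), inv_mul_cancel₀ hφ1.ne'⟩
  exact (mul_neg_of_pos_of_neg hinv hφa).not_ge hψ

lemma closure_convexHull_extremePoints_stateSpace :
    closure (convexHull ℝ ((stateSpace A).extremePoints ℝ)) = stateSpace A := by
  have := WeakDual.instContinuousSMul (𝕜 := ℂ) (E := A) ℝ
  have : LocallyConvexSpace ℝ (WeakDual ℂ A) :=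
    WeakBilin.locallyConvexSpace (B := topDualPairing ℂ A)
  exact closure_convexHull_extremePoints (isCompact_stateSpace A) (convex_stateSpace A)

lemma nonneg_of_forall_extremePoints_stateSpace {a : A} (ha : IsSelfAdjoint a)
    (h : ∀ φ ∈ (stateSpace A).extremePoints ℝ, 0 ≤ φ a) : 0 ≤ a := by
  have hcl : IsClosed {φ : WeakDual ℂ A | 0 ≤ φ a} :=
    isClosed_le continuous_const (WeakDual.eval_continuous a)
  have hcv : Convex ℝ {φ : WeakDual ℂ A | 0 ≤ φ a} := fun φ hφ ψ hψ s t hs ht _ ↦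
    add_nonneg (smul_nonneg hs (show 0 ≤ φ a from hφ)) (smul_nonneg ht (show 0 ≤ ψ a from hψ))
  have hsub : closure (convexHull ℝ ((stateSpace A).extremePoints ℝ)) ⊆
      {φ : WeakDual ℂ A | 0 ≤ φ a} := closure_minimal (convexHull_min h hcv) hcl
  rw [closure_convexHull_extremePoints_stateSpace] at hsub
  exact nonneg_of_forall_stateSpace ha hsub

end States

section VectorFunctional

open scoped CStarAlgebra

variable {A : Type*} [CStarAlgebra A]
variable {H : Type*} [NormedAddCommGroup H] [InnerProductSpace ℂ H] [CompleteSpace H]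
variable (π : A →⋆ₐ[ℂ] (H →L[ℂ] H))

/-- The vector functional `a ↦ ⟪ζ, π a ζ⟫`, which is a state when `‖ζ‖ = 1`. -/
noncomputable def vectorFunctional (ζ : H) : WeakDual ℂ A :=
  StrongDual.toWeakDual <|
    innerSL ℂ ζ ∘L apply ℂ H ζ ∘L ⟨π.toAlgHom.toLinearMap, map_continuous π⟩

@[simp]
lemma vectorFunctional_apply (ζ : H) (a : A) : vectorFunctional π ζ a = inner ℂ ζ (π a ζ) := rfl

lemma vectorFunctional_apply_one (ζ : H) : vectorFunctional π ζ 1 = (‖ζ‖ ^ 2 : ℝ) := by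
  simp [inner_self_eq_norm_sq_to_K]

lemma vectorFunctional_zero : vectorFunctional π 0 = 0 :=
  DFunLike.ext _ _ fun _ ↦ inner_zero_left _

variable {K : Submodule ℂ H} {p q : H}

lemma inner_apply_add_of_invariant (hK : ∀ a, ∀ x ∈ K, π a x ∈ K) (hp : p ∈ K) (hq : q ∈ Kᗮ)
    (a : A) : inner ℂ p (π a (p + q)) = vectorFunctional π p a := by
  rw [map_add, inner_add_right, vectorFunctional_apply,
    Submodule.inner_right_of_mem_orthogonal hp (apply_mem_orthogonal_of_invariant π hK a hq),
    add_zero]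

lemma vectorFunctional_add_of_invariant (hK : ∀ a, ∀ x ∈ K, π a x ∈ K) (hp : p ∈ K)
    (hq : q ∈ Kᗮ) :
    vectorFunctional π (p + q) = vectorFunctional π p + vectorFunctional π q := by
  refine DFunLike.ext _ _ fun a ↦ ?_
  change inner ℂ (p + q) (π a (p + q)) = inner ℂ p (π a p) + inner ℂ q (π a q)
  rw [inner_add_left, inner_apply_add_of_invariant π hK hp hq, map_add, inner_add_right,
    Submodule.inner_left_of_mem_orthogonal (hK a p hp) hq, zero_add, vectorFunctional_apply]

variable [PartialOrder A] [StarOrderedRing A]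

lemma vectorFunctional_apply_nonneg (ζ : H) {a : A} (ha : 0 ≤ a) : 0 ≤ vectorFunctional π ζ a :=
  ((nonneg_iff_isPositive _).1 (map_nonneg π ha)).inner_nonneg_right ζ

lemma inv_smul_vectorFunctional_mem_stateSpace {ζ : H} (hζ : ζ ≠ 0) :
    (‖ζ‖ ^ 2)⁻¹ • vectorFunctional π ζ ∈ stateSpace A := by
  refine ⟨fun a ha ↦ smul_nonneg (inv_nonneg.2 (sq_nonneg ‖ζ‖))
    (vectorFunctional_apply_nonneg π ζ ha), ?_⟩
  change (‖ζ‖ ^ 2)⁻¹ • vectorFunctional π ζ 1 = 1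
  rw [vectorFunctional_apply_one, ← Complex.coe_smul, smul_eq_mul, ← Complex.ofReal_mul,
    inv_mul_cancel₀ (by simpa using hζ), Complex.ofReal_one]

variable {π}

lemma vectorFunctional_eq_smul_of_mem_extremePoints {ξ : H}
    (hξ : vectorFunctional π ξ ∈ (stateSpace A).extremePoints ℝ)
    (hpq : vectorFunctional π ξ = vectorFunctional π p + vectorFunctional π q) :
    vectorFunctional π p = ‖p‖ ^ 2 • vectorFunctional π ξ := by
  have hnorm : ‖p‖ ^ 2 + ‖q‖ ^ 2 = 1 := by
    have h1 : vectorFunctional π p 1 + vectorFunctional π q 1 = 1 :=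
      congr($hpq 1).symm.trans hξ.1.2
    rw [vectorFunctional_apply_one, vectorFunctional_apply_one] at h1
    exact_mod_cast h1
  rcases eq_or_ne p 0 with rfl | hp
  · rw [vectorFunctional_zero, show ‖(0 : H)‖ ^ 2 = 0 by simp, zero_smul ℝ (_ : WeakDual ℂ A)]
  rcases eq_or_ne q 0 with rfl | hq
  · rw [hpq, vectorFunctional_zero, add_zero, show ‖p‖ ^ 2 = 1 by simpa using hnorm,
      one_smul ℝ (_ : WeakDual ℂ A)]
  have hp2 : 0 < ‖p‖ ^ 2 := by positivity
  have hq2 : 0 < ‖q‖ ^ 2 := by positivity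
  have hseg : vectorFunctional π ξ ∈ openSegment ℝ
      ((‖p‖ ^ 2)⁻¹ • vectorFunctional π p) ((‖q‖ ^ 2)⁻¹ • vectorFunctional π q) :=
    ⟨‖p‖ ^ 2, ‖q‖ ^ 2, hp2, hq2, hnorm, by
      rw [smul_inv_smul₀ hp2.ne' (_ : WeakDual ℂ A), smul_inv_smul₀ hq2.ne' (_ : WeakDual ℂ A),
        hpq]⟩
  have heq := (mem_extremePoints_iff_left.1 hξ).2 _ (inv_smul_vectorFunctional_mem_stateSpace π hp)
    _ (inv_smul_vectorFunctional_mem_stateSpace π hq) hseg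
  rw [← heq, smul_inv_smul₀ hp2.ne' (_ : WeakDual ℂ A)]

lemma starProjection_eq_smul_of_mem_extremePoints {ξ : H} (hcyc : DenseRange fun a ↦ π a ξ)
    (hξ : vectorFunctional π ξ ∈ (stateSpace A).extremePoints ℝ) [K.HasOrthogonalProjection]
    (hK : ∀ a, ∀ x ∈ K, π a x ∈ K) : ∃ c : ℝ, K.starProjection ξ = c • ξ := by
  set p := K.starProjection ξ
  have hpK : p ∈ K := K.starProjection_apply_mem ξ
  have hqK : ξ - p ∈ Kᗮ := K.sub_starProjection_mem_orthogonal ξ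
  have hadd : p + (ξ - p) = ξ := add_sub_cancel p ξ
  have hstate : vectorFunctional π p = ‖p‖ ^ 2 • vectorFunctional π ξ :=
    vectorFunctional_eq_smul_of_mem_extremePoints hξ <| by
      conv_lhs => rw [← hadd, vectorFunctional_add_of_invariant π hK hpK hqK]
  have hinner (a : A) : inner ℂ p (π a ξ) = inner ℂ (‖p‖ ^ 2 • ξ) (π a ξ) := by
    have := inner_apply_add_of_invariant π hK hpK hqK a
    rw [hadd, hstate] at this
    exact this.trans (inner_smul_left_eq_smul ξ (π a ξ) (‖p‖ ^ 2)).symm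
  exact ⟨‖p‖ ^ 2, hcyc.eq_of_inner_left ℂ hinner⟩

/-- Extremality of the vector state makes every invariant projection fix the line through the
cyclic vector, so by cyclicity the projection is a scalar. -/
theorem isIrreducibleRep_of_mem_extremePoints {ξ : H} (hcyc : DenseRange fun a ↦ π a ξ)
    (hξ : vectorFunctional π ξ ∈ (stateSpace A).extremePoints ℝ) : IsIrreducibleRep π := by
  have hξ0 : ξ ≠ 0 := by
    rintro rfl
    simpa using hξ.1.2
  refine ⟨⟨ξ, 0, hξ0⟩, fun K hK hinv ↦ ?_⟩
  have : CompleteSpace K := hK.completeSpace_coe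
  obtain ⟨c, hc⟩ := starProjection_eq_smul_of_mem_extremePoints hcyc hξ hinv
  have hscalar : (K.starProjection : H → H) = (c • ·) := by
    refine hcyc.equalizer K.starProjection.continuous (continuous_const_smul c) ?_
    ext a
    have := congr($((commute_starProjection_of_invariant π hinv a).eq) ξ)
    simpa [hc] using this
  rcases eq_or_ne c 0 with rfl | hc0
  · refine .inl (K.eq_bot_iff.2 fun x hx ↦ ?_)
    simpa [hscalar] using (Submodule.starProjection_eq_self_iff.2 hx).symm
  · refine .inr (eq_top_iff.2 fun x _ ↦ ?_)
    have hx : K.starProjection (c⁻¹ • x) = x := by simp [hscalar, hc0]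
    exact hx ▸ K.starProjection_apply_mem _

end VectorFunctional

section GNS

variable {A : Type*} [CStarAlgebra A] [PartialOrder A] [StarOrderedRing A]

lemma inner_gnsStarAlgHom_toPreGNS_one (f : A →ₚ[ℂ] ℂ) (a : A) :
    inner ℂ (f.toPreGNS 1 : f.GNS) (f.gnsStarAlgHom a (f.toPreGNS 1 : f.GNS)) = f a := by
  simp [PositiveLinearMap.preGNS_inner_def]

lemma denseRange_gnsStarAlgHom_toPreGNS_one (f : A →ₚ[ℂ] ℂ) :
    DenseRange fun a : A ↦ f.gnsStarAlgHom a (f.toPreGNS 1 : f.GNS) := by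
  have hcoe : (fun a : A ↦ f.gnsStarAlgHom a (f.toPreGNS 1 : f.GNS)) =
      ((↑) : f.PreGNS → f.GNS) ∘ f.toPreGNS := by
    ext a
    simp
  rw [hcoe]
  exact UniformSpace.Completion.denseRange_coe.comp f.toPreGNS.surjective.denseRange
    (UniformSpace.Completion.continuous_coe _)

end GNS

section Separation

variable {A : Type u} [CStarAlgebra A] [PartialOrder A] [StarOrderedRing A]

theorem nonneg_of_forall_isIrreducibleRep {a : A} (ha : IsSelfAdjoint a)
    (h : ∀ (H : Type u) [NormedAddCommGroup H] [InnerProductSpace ℂ H] [CompleteSpace H]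
      (π : A →⋆ₐ[ℂ] (H →L[ℂ] H)), IsIrreducibleRep π → 0 ≤ π a) : 0 ≤ a := by
  refine nonneg_of_forall_extremePoints_stateSpace ha fun φ hφ ↦ ?_
  let f : A →ₚ[ℂ] ℂ := .mk₀ φ.toLinearMap hφ.1.1
  let ξ : f.GNS := f.toPreGNS 1
  have hφξ : vectorFunctional f.gnsStarAlgHom ξ = φ :=
    DFunLike.ext _ _ (inner_gnsStarAlgHom_toPreGNS_one f)
  have hirr : IsIrreducibleRep f.gnsStarAlgHom :=
    isIrreducibleRep_of_mem_extremePoints (denseRange_gnsStarAlgHom_toPreGNS_one f) (hφξ ▸ hφ)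
  rw [← hφξ]
  exact ((nonneg_iff_isPositive _).1 (h f.GNS f.gnsStarAlgHom hirr)).inner_nonneg_right ξ

theorem mem_monotoneClass_of_forall_isIrreducibleRep {f : ℝ → ℝ} (hf : ContinuousOn f (Ici 0))
    (h : ∀ (H : Type u) [NormedAddCommGroup H] [InnerProductSpace ℂ H] [CompleteSpace H]
      (π : A →⋆ₐ[ℂ] (H →L[ℂ] H)), IsIrreducibleRep π → f ∈ monotoneClass (Ici 0) (H →L[ℂ] H)) :
    f ∈ monotoneClass (Ici 0) A := by
  rw [mem_monotoneClass_Ici_iff]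
  refine ⟨hf, fun x y hx hxy ↦ ?_⟩
  rw [← sub_nonneg]
  refine nonneg_of_forall_isIrreducibleRep ((cfc_predicate f y).sub (cfc_predicate f x))
    fun H _ _ _ π hπ ↦ ?_
  rw [map_sub, map_cfc_of_nonneg π hf hx, map_cfc_of_nonneg π hf (hx.trans hxy), sub_nonneg]
  exact (mem_monotoneClass_Ici_iff.1 (h H π hπ)).2 _ _ (map_nonneg π hx) (OrderHomClass.mono π hxy)

theorem matrixMonotoneClass_subset_of_irrepDimsLE {n : ℕ} (h : IrrepDimsLE A n) :
    matrixMonotoneClass (Ici 0) n ⊆ monotoneClass (Ici 0) A := fun _ hf ↦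
  mem_monotoneClass_of_forall_isIrreducibleRep hf.1 fun H _ _ _ π hπ ↦
    have := (h H π hπ).1
    matrixMonotoneClass_subset_of_finrank_le (h H π hπ).2 hf

theorem matrixMonotoneClassInf_subset_monotoneClass :
    matrixMonotoneClassInf (Ici 0) ⊆ monotoneClass (Ici 0) A := fun _ hf ↦
  mem_monotoneClass_of_forall_isIrreducibleRep (mem_iInter₂.1 hf 1 le_rfl).1
    fun _ _ _ _ _ _ ↦ matrixMonotoneClassInf_subset hf

end Separation

section RepresentationDimensions

variable {A : Type u} [CStarAlgebra A] [PartialOrder A] [StarOrderedRing A]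

lemma isOperatorMonotoneClass_matrixMonotoneClassInf :
    IsOperatorMonotoneClass.{w} (Ici 0) (matrixMonotoneClassInf (Ici 0)) :=
  ⟨rfl, fun _ _ _ _ hK ↦
    matrixMonotoneClassInf_subset.antisymm (monotoneClass_subset_matrixMonotoneClassInf hK)⟩

lemma isOperatorMonotoneClass_monotoneClass_of_subset
    (h : monotoneClass (Ici 0) A ⊆ matrixMonotoneClassInf (Ici 0)) :
    IsOperatorMonotoneClass.{w} (Ici 0) (monotoneClass (Ici 0) A) := by
  rw [h.antisymm matrixMonotoneClassInf_subset_monotoneClass]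
  exact isOperatorMonotoneClass_matrixMonotoneClassInf

theorem HasIrrepOfDim.monotoneClass_subset {m n : ℕ} (h : HasIrrepOfDim.{v} A n) (hm : m ≤ n) :
    monotoneClass (Ici 0) A ⊆ matrixMonotoneClass (Ici 0) m := by
  obtain ⟨H, _, _, _, π, hπ, _, hn⟩ := h
  refine hπ.monotoneClass_subset.trans (monotoneClass_subset_matrixMonotoneClass_of_le_rank ?_)
  rw [← Module.finrank_eq_rank, hn]
  exact_mod_cast hm

theorem HasInfiniteDimIrrep.monotoneClass_subset (h : HasInfiniteDimIrrep.{v} A) :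
    monotoneClass (Ici 0) A ⊆ matrixMonotoneClassInf (Ici 0) := by
  obtain ⟨H, _, _, _, π, hπ, hH⟩ := h
  exact hπ.monotoneClass_subset.trans (monotoneClass_subset_matrixMonotoneClassInf hH)

theorem monotoneClass_subset_matrixMonotoneClassInf_of_not_bddAbove
    (h : ¬ BddAbove {n : ℕ | HasIrrepOfDim.{v} A n}) :
    monotoneClass (Ici 0) A ⊆ matrixMonotoneClassInf (Ici 0) := by
  refine subset_iInter₂ fun m _ ↦ ?_
  obtain ⟨n, hn, hmn⟩ := not_bddAbove_iff.1 h m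
  exact hn.monotoneClass_subset hmn.le

end RepresentationDimensions

theorem lemma2p1 (A : Type u) [CStarAlgebra A] [PartialOrder A] [StarOrderedRing A] :
    (∀ n : ℕ, HasIrrepOfDim.{v} A n →
      monotoneClass (Set.Ici 0) A ⊆ matrixMonotoneClass (Set.Ici 0) n) ∧
    (∀ n : ℕ, IrrepDimsLE A n →
      matrixMonotoneClass (Set.Ici 0) n ⊆ monotoneClass (Set.Ici 0) A) ∧
    (¬ BddAbove {n : ℕ | HasIrrepOfDim.{v} A n} →
      IsOperatorMonotoneClass.{w} (Set.Ici 0) (monotoneClass (Set.Ici 0) A)) ∧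
    (HasInfiniteDimIrrep.{v} A →
      IsOperatorMonotoneClass.{w} (Set.Ici 0) (monotoneClass (Set.Ici 0) A)) := by
  refine ⟨fun n h ↦ ?_, fun n h ↦ ?_, fun h ↦ ?_, fun h ↦ ?_⟩
  · exact h.monotoneClass_subset le_rfl
  · exact matrixMonotoneClass_subset_of_irrepDimsLE h
  · exact isOperatorMonotoneClass_monotoneClass_of_subset
      (monotoneClass_subset_matrixMonotoneClassInf_of_not_bddAbove h)
  · exact isOperatorMonotoneClass_monotoneClass_of_subset h.monotoneClass_subset
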